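/- Let $R$ be a commutative Noetherian Henselian local ring with maximal ideal $\mathfrak m$, and let $\operatorname{mod} R$ be the category of finitely generated $R$-modules. Write $(-)^*=\operatorname{Hom}_R(-,R)$. A module $X\in\operatorname{mod} R$ is called G-projective if the natural map $X\to X^{**}$ is an isomorphism and $\operatorname{Ext}^i_R(X,R)=0=\operatorname{Ext}^i_R(X^*,R)$ for all $i>0$; let $\mathcal G$ be the full subcategory of $\operatorname{mod} R$ of all G-projective modules. A right $\mathcal G$-approximation of $M\in\operatorname{mod} R$ is a homomorphism $\phi:X\to M$ with $X\in\mathcal G$ such that every homomorphism $X'\to M$ with $X'\in\mathcal G$ factors through $\phi$; a left $\mathcal G$-approximation of $M$ is a homomorphism $\phi:M\to X$ with $X\in\mathcal G$ such that every homomorphism $M\to X'$ with $X'\in\mathcal G$ factors through $\phi$. Let $\operatorname{rap}\mathcal G$ (resp. $\operatorname{lap}\mathcal G$) be the full subcategory of $\operatorname{mod} R$ of all modules that have a right (resp. left) $\mathcal G$-approximation. For $M\in\operatorname{mod} R$ let $F_1\xrightarrow{\delta}F_0\to M\to 0$ be a minimal free presentation, that is, an exact sequence with $F_0,F_1$ free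 of finite rank, $\operatorname{Im}\delta\subseteq\mathfrak mF_0$ and $\operatorname{Ker}\delta\subseteq\mathfrak mF_1$. The (Auslander) transpose of $M$ is $\operatorname{Tr}M=\operatorname{Coker}(\delta^*:F_0^*\to F_1^*)$, which is determined by $M$ up to isomorphism. A subcategory $\mathcal X$ of $\operatorname{mod} R$ is closed under transpose if $\operatorname{Tr}X\in\mathcal X$ for all $X\in\mathcal X$. Then: 1. For every $M\in\operatorname{mod} R$: $M\in\operatorname{rap}\mathcal G$ if and only if $\operatorname{Tr}M\in\operatorname{lap}\mathcal G$, and $M\in\operatorname{lap}\mathcal G$ if and only if $\operatorname{Tr}M\in\operatorname{rap}\mathcal G$. 2. $\operatorname{rap}\mathcal G$ is closed under transpose if and only if $\operatorname{lap}\mathcal G\subseteq\operatorname{rap}\mathcal G$. -/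

import Mathlib

open CategoryTheory

universe u

namespace GProj

variable (R : Type u) [CommRing R]

/-- A finitely generated module `X` over a commutative Noetherian ring is G-projective if it is
reflexive and `Ext^i(X, R) = 0 = Ext^i(X^*, R)` for all `i > 0`, where `X^* = Hom(X, R)`. -/
structure IsGProjective (X : Type u) [AddCommGroup X] [Module R X] : Prop where
  reflexive : Function.Bijective (Module.Dual.eval R X)
  ext_eq_zero : ∀ i : ℕ, 0 < i →
    Subsingleton (Abelian.Ext (ModuleCat.of R X) (ModuleCat.of R R) i)
  ext_dual_eq_zero : ∀ i : ℕ, 0 < i →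
    Subsingleton (Abelian.Ext (ModuleCat.of R (Module.Dual R X)) (ModuleCat.of R R) i)

/-- The subcategory `𝒢` of `mod R` of all (finitely generated) G-projective modules. -/
def gProjective : ObjectProperty (FGModuleCat.{u} R) :=
  fun X => IsGProjective R X

variable {R}

/-- `φ : X → M` is a right `𝒳`-approximation of `M`. -/
def IsRightApprox (𝒳 : ObjectProperty (FGModuleCat.{u} R)) {X M : FGModuleCat.{u} R}
    (φ : X →ₗ[R] M) : Prop :=
  𝒳 X ∧ ∀ X' : FGModuleCat.{u} R, 𝒳 X' → ∀ φ' : X' →ₗ[R] M, ∃ f : X' →ₗ[R] X, φ' = φ ∘ₗ f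

/-- `φ : M → X` is a left `𝒳`-approximation of `M`. -/
def IsLeftApprox (𝒳 : ObjectProperty (FGModuleCat.{u} R)) {M X : FGModuleCat.{u} R}
    (φ : M →ₗ[R] X) : Prop :=
  𝒳 X ∧ ∀ X' : FGModuleCat.{u} R, 𝒳 X' → ∀ φ' : M →ₗ[R] X', ∃ f : X →ₗ[R] X', φ' = f ∘ₗ φ

/-- `rap 𝒳`: the modules in `mod R` that have a right `𝒳`-approximation. -/
def rap (𝒳 : ObjectProperty (FGModuleCat.{u} R)) : ObjectProperty (FGModuleCat.{u} R) :=
  fun M => ∃ (X : FGModuleCat.{u} R) (φ : X →ₗ[R] M), IsRightApprox 𝒳 φ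

/-- `lap 𝒳`: the modules in `mod R` that have a left `𝒳`-approximation. -/
def lap (𝒳 : ObjectProperty (FGModuleCat.{u} R)) : ObjectProperty (FGModuleCat.{u} R) :=
  fun M => ∃ (X : FGModuleCat.{u} R) (φ : M →ₗ[R] X), IsLeftApprox 𝒳 φ

/-- `F₁ --δ--> F₀ --π--> M → 0` is a minimal free presentation of `M` over the local ring `R`:
an exact sequence with `F₀`, `F₁` free of finite rank in which both `F₀ → M` and
`F₁ → Ker π` are minimal, i.e. `Im δ = Ker π ⊆ 𝔪 F₀` and `Ker δ ⊆ 𝔪 F₁`. -/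
structure IsMinimalFreePresentation [IsLocalRing R] {F₁ F₀ M : FGModuleCat.{u} R}
    (δ : F₁ →ₗ[R] F₀) (π : F₀ →ₗ[R] M) : Prop where
  free₁ : Module.Free R F₁
  free₀ : Module.Free R F₀
  surjective : Function.Surjective π
  exact : Function.Exact δ π
  range_le : LinearMap.range δ ≤ IsLocalRing.maximalIdeal R • (⊤ : Submodule R F₀)
  ker_le : LinearMap.ker δ ≤ IsLocalRing.maximalIdeal R • (⊤ : Submodule R F₁)

/-- `T` is (isomorphic to) the Auslander transpose `Tr M`: the cokernel of
`δ^* : F₀^* → F₁^*` for a minimal free presentation `F₁ --δ--> F₀ → M → 0`. -/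
def IsTranspose [IsLocalRing R] (M T : FGModuleCat.{u} R) : Prop :=
  ∃ (F₁ F₀ : FGModuleCat.{u} R) (δ : F₁ →ₗ[R] F₀) (π : F₀ →ₗ[R] M),
    IsMinimalFreePresentation δ π ∧
      Nonempty (T ≃ₗ[R] (Module.Dual R F₁ ⧸ LinearMap.range δ.dualMap))

/-- `𝒳` is closed under transposes: `Tr X` lies in `𝒳` for every `X` in `𝒳`. -/
def ClosedUnderTranspose [IsLocalRing R] (𝒳 : ObjectProperty (FGModuleCat.{u} R)) : Prop :=
  ∀ M T : FGModuleCat.{u} R, IsTranspose M T → 𝒳 M → 𝒳 T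

/-- Every finitely generated module over a local ring has a minimal free cover. -/
theorem exists_minimal_cover [IsLocalRing R] (M : Type u) [AddCommGroup M] [Module R M]
    [Module.Finite R M] : ∃ (n : ℕ) (π : (Fin n → R) →ₗ[R] M), Function.Surjective π ∧
      LinearMap.ker π ≤ IsLocalRing.maximalIdeal R • (⊤ : Submodule R (Fin n → R)) := by
  let k := IsLocalRing.ResidueField R
  let b := Module.finBasis k (TensorProduct R k M)
  have hs := TensorProduct.mk_surjective R M k IsLocalRing.residue_surjective
  choose v hv using fun i => hs (b i)
  have hspan := IsLocalRing.span_eq_top_of_tmul_eq_basis (R := R) (M := M) v b hv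
  refine ⟨_, Fintype.linearCombination R v, ?_, ?_⟩
  · rw [← LinearMap.range_eq_top, Fintype.range_linearCombination, hspan]
  · intro c hc
    rw [LinearMap.mem_ker, Fintype.linearCombination_apply] at hc
    have h1 : ∑ i, IsLocalRing.residue R (c i) • b i = 0 := by
      have := congrArg (TensorProduct.mk R k M 1) hc
      simp only [map_sum, map_smul, map_zero, hv] at this
      rw [← this]
      refine Finset.sum_congr rfl fun i _ => ?_
      exact algebraMap_smul k (c i) (b i)
    have h2 := Fintype.linearIndependent_iff.mp b.linearIndependent _ h1
    rw [pi_eq_sum_univ' c]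
    refine Submodule.sum_mem _ fun i _ => Submodule.smul_mem_smul ?_ trivial
    exact (IsLocalRing.residue_eq_zero_iff _).mp (h2 i)

/-- Every finitely generated module over a Noetherian local ring has an Auslander transpose. -/
theorem exists_isTranspose [IsLocalRing R] [IsNoetherianRing R] (M : FGModuleCat.{u} R) :
    ∃ T : FGModuleCat.{u} R, IsTranspose M T := by
  obtain ⟨n, π, hπ, hπk⟩ := exists_minimal_cover (R := R) M
  obtain ⟨m, ρ, hρ, hρk⟩ := exists_minimal_cover (R := R) (LinearMap.ker π)
  let δ : (Fin m → R) →ₗ[R] (Fin n → R) := (LinearMap.ker π).subtype ∘ₗ ρ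
  have hr : LinearMap.range δ = LinearMap.ker π := by
    simp [δ, LinearMap.range_comp, LinearMap.range_eq_top.mpr hρ]
  have hk : LinearMap.ker δ = LinearMap.ker ρ := by
    simp [δ, LinearMap.ker_comp]
  refine ⟨FGModuleCat.of R (Module.Dual R (Fin m → R) ⧸ LinearMap.range δ.dualMap),
    FGModuleCat.of R (Fin m → R), FGModuleCat.of R (Fin n → R), δ, π, ?_,
    ⟨LinearEquiv.refl R _⟩⟩
  exact ⟨inferInstanceAs (Module.Free R (Fin m → R)), inferInstanceAs (Module.Free R (Fin n → R)),
    hπ, LinearMap.exact_iff.mpr hr.symm, hr.trans_le hπk, hk.trans_le hρk⟩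

end GProj

/-!
The transpose is a duality of `mod R` modulo maps that factor through free modules, it preserves
`𝒢`, and having a `𝒢`-approximation can be tested modulo such maps; so it exchanges right and left
`𝒢`-approximations.

A presentation of `M` together with its transpose `T` is encoded by a matrix `A` with cokernel `M`
whose transpose has cokernel `T` (`TransposePresentation`). This notion is symmetric in `M` and
`T`. A map `φ : M → M'` lifts to a pair of matrices, whose transposes induce a map `ψ : T' → T`
(`AreTransposed`); by the same argument every `ψ` arises from some `φ`, and if `φ = 0` then `ψ`
factors through a free module (`AreTransposed.exists_factor_of_zero`).

The transpose preserves `𝒢` because, by the exact sequences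
`0 → X^* → R^n → R^m → Tr X → 0` and
`0 → Ext^1(Tr X, R) → X → X^{**} → Ext^2(Tr X, R) → 0`,
a module `X` is G-projective exactly when `Ext^i(X, R) = 0 = Ext^i(Tr X, R)` for all `i > 0`
(`isGProjective_iff`), a condition symmetric in `X` and `Tr X`.

Given a right `𝒢`-approximation `φ : X → M`, let `ψ : Tr M → Tr X` be a transpose of `φ`. A map
`f : Tr M → Z` with `Z` in `𝒢` is a transpose of some map `Tr Z → M`, which factors through `φ`;
hence `f` factors through `ψ` up to a map that factors through a free module. Adding to `ψ` a left
approximation of `Tr M` by free modules absorbs this error term (`lap_of_rap`). The argument for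
left approximations is dual: there the error term is absorbed by the projection of a free module
onto `Tr M` (`rap_of_lap`).
-/

namespace GProj

/-! ### Dimension shifting for `Ext` -/

section Ext

variable {R : Type u} [CommRing R] {K P C : Type u} [AddCommGroup K] [Module R K]
  [AddCommGroup P] [Module R P] [AddCommGroup C] [Module R C]

theorem shortExact_of_linearMap {f : K →ₗ[R] P} {g : P →ₗ[R] C} (hf : Function.Injective f)
    (hg : Function.Surjective g) (hfg : Function.Exact f g) :
    (ShortComplex.mk (ModuleCat.ofHom f) (ModuleCat.ofHom g)
      (by ext x; exact hfg.apply_apply_eq_zero x)).ShortExact :=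
  ModuleCat.shortComplex_shortExact _ hfg hf hg

theorem subsingleton_ext_add_two_iff [Module.Projective R P] {f : K →ₗ[R] P} {g : P →ₗ[R] C}
    (hf : Function.Injective f) (hg : Function.Surjective g) (hfg : Function.Exact f g)
    (N : ModuleCat.{u} R) (i : ℕ) :
    Subsingleton (Abelian.Ext (ModuleCat.of R C) N (i + 2)) ↔
      Subsingleton (Abelian.Ext (ModuleCat.of R K) N (i + 1)) := by
  have hS := shortExact_of_linearMap hf hg hfg
  have : Projective (ModuleCat.of R P) :=
    (IsProjective.iff_projective (R := R) P).mp inferInstance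
  constructor <;> intro h
  · refine subsingleton_of_forall_eq 0 fun x => ?_
    obtain ⟨y, rfl⟩ := Abelian.Ext.contravariant_sequence_exact₁ hS N x
      (n₁ := i + 2) (by omega) (h.elim _ _)
    rw [Abelian.Ext.eq_zero_of_projective y, Abelian.Ext.comp_zero]
  · refine subsingleton_of_forall_eq 0 fun x => ?_
    obtain ⟨y, rfl⟩ := Abelian.Ext.contravariant_sequence_exact₃ hS N x
      (Abelian.Ext.eq_zero_of_projective _) (n₀ := i + 1) (by omega)
    rw [h.elim y 0, Abelian.Ext.comp_zero]

/-- `Ext^1(C, N)` is the cokernel of `Hom(P, N) → Hom(K, N)`. -/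
theorem subsingleton_ext_one_iff [Module.Projective R P] {f : K →ₗ[R] P} {g : P →ₗ[R] C}
    (hf : Function.Injective f) (hg : Function.Surjective g) (hfg : Function.Exact f g)
    (N : Type u) [AddCommGroup N] [Module R N] :
    Subsingleton (Abelian.Ext (ModuleCat.of R C) (ModuleCat.of R N) 1) ↔
      ∀ a : K →ₗ[R] N, ∃ b : P →ₗ[R] N, b ∘ₗ f = a := by
  have hS := shortExact_of_linearMap hf hg hfg
  have : Projective (ModuleCat.of R P) :=
    (IsProjective.iff_projective (R := R) P).mp inferInstance
  constructor
  · intro h a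
    obtain ⟨y, hy⟩ := Abelian.Ext.contravariant_sequence_exact₁ hS (ModuleCat.of R N)
      (Abelian.Ext.mk₀ (ModuleCat.ofHom a)) (n₁ := 1) rfl (h.elim _ _)
    obtain ⟨b, rfl⟩ := (Abelian.Ext.mk₀_bijective _ _).2 y
    rw [Abelian.Ext.mk₀_comp_mk₀] at hy
    have := (Abelian.Ext.mk₀_bijective _ _).1 hy
    exact ⟨b.hom, congrArg ModuleCat.Hom.hom this⟩
  · refine fun h => subsingleton_of_forall_eq 0 fun x => ?_
    obtain ⟨y, rfl⟩ := Abelian.Ext.contravariant_sequence_exact₃ hS (ModuleCat.of R N) x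
      (Abelian.Ext.eq_zero_of_projective _) (n₀ := 0) rfl
    obtain ⟨a, rfl⟩ := (Abelian.Ext.mk₀_bijective _ _).2 y
    obtain ⟨b, hb⟩ := h a.hom
    have : a = ModuleCat.ofHom f ≫ ModuleCat.ofHom b := by
      ext x; exact (LinearMap.congr_fun hb x).symm
    rw [this, ← Abelian.Ext.mk₀_comp_mk₀]
    exact hS.extClass_comp_assoc _

end Ext

/-! ### Lifting and descending linear maps -/

section Lifting

variable {R : Type*} [CommRing R] {P M N : Type*} [AddCommGroup P] [Module R P]
  [AddCommGroup M] [Module R M] [AddCommGroup N] [Module R N]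

theorem exists_comp_eq_of_ker_le {g : P →ₗ[R] M} (hg : Function.Surjective g) (f : P →ₗ[R] N)
    (h : LinearMap.ker g ≤ LinearMap.ker f) : ∃ f' : M →ₗ[R] N, f' ∘ₗ g = f := by
  refine ⟨(LinearMap.ker g).liftQ f h ∘ₗ (g.quotKerEquivOfSurjective hg).symm, ?_⟩
  ext x
  have : (g.quotKerEquivOfSurjective hg).symm (g x) = (LinearMap.ker g).mkQ x := by
    rw [LinearEquiv.symm_apply_eq]; rfl
  simp [this]

theorem exists_comp_eq_of_exact {L : Type*} [AddCommGroup L] [Module R L] {d : L →ₗ[R] P}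
    {g : P →ₗ[R] M} (hg : Function.Surjective g) (hd : Function.Exact d g) (f : P →ₗ[R] N)
    (h : f ∘ₗ d = 0) : ∃ f' : M →ₗ[R] N, f' ∘ₗ g = f := by
  refine exists_comp_eq_of_ker_le hg f ?_
  rw [LinearMap.exact_iff.mp hd]
  exact LinearMap.range_le_ker_iff.mpr h

theorem exists_matrix_comp_eq {m n : Type*} [Fintype m] [Fintype n]
    {g : (n → R) →ₗ[R] M} (hg : Function.Surjective g) (f : (m → R) →ₗ[R] M) :
    ∃ U : Matrix n m R, g ∘ₗ U.mulVecLin = f := by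
  classical
  obtain ⟨h, hh⟩ := Module.projective_lifting_property g f hg
  exact ⟨LinearMap.toMatrix' h, by rw [← Matrix.toLin'_apply', Matrix.toLin'_toMatrix', hh]⟩

theorem exists_matrix_mul_eq {l m n : Type*} [Fintype l] [Fintype m] [Fintype n]
    {A : Matrix n m R} {g : (n → R) →ₗ[R] M} (hg : Function.Exact A.mulVecLin g)
    (U : Matrix n l R) (h : g ∘ₗ U.mulVecLin = 0) : ∃ V : Matrix m l R, A * V = U := by
  classical
  have hU : ∀ j, ∃ v, A.mulVecLin v = U.col j := fun j => by
    refine (hg _).mp ?_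
    simpa using LinearMap.congr_fun h (Pi.single j 1)
  choose v hv using hU
  refine ⟨(Matrix.of v).transpose, ?_⟩
  ext i j
  simpa [Matrix.mul_apply, Matrix.mulVec, dotProduct] using congrFun (hv j) i

end Lifting

theorem mulVecLin_sub {R m n : Type*} [CommRing R] [Fintype n] (A B : Matrix m n R) :
    (A - B).mulVecLin = A.mulVecLin - B.mulVecLin :=
  LinearMap.ext fun v => Matrix.sub_mulVec A B v

/-! ### Transposed presentations -/

/-- A matrix `A` over `R` with its cokernel `M` and the cokernel `T` of its transpose: exact
sequences `R^m --A--> R^n --π--> M → 0` and `R^n --Aᵀ--> R^m --τ--> T → 0`. Up to a choice of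
bases this is a finite free presentation of `M`, not required to be minimal, together with the
corresponding Auslander transpose `T`. -/
structure TransposePresentation (R : Type*) [CommRing R] (M T : Type*) [AddCommGroup M]
    [Module R M] [AddCommGroup T] [Module R T] where
  m : Type
  n : Type
  [fintype_m : Fintype m]
  [fintype_n : Fintype n]
  A : Matrix n m R
  π : (n → R) →ₗ[R] M
  τ : (m → R) →ₗ[R] T
  surjective_π : Function.Surjective π
  surjective_τ : Function.Surjective τ
  exact_π : Function.Exact A.mulVecLin π
  exact_τ : Function.Exact A.transpose.mulVecLin τ

attribute [instance] TransposePresentation.fintype_m TransposePresentation.fintype_n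

namespace TransposePresentation

section Maps

variable {R : Type*} [CommRing R] {M T M' T' M'' T'' : Type*}
  [AddCommGroup M] [Module R M] [AddCommGroup T] [Module R T]
  [AddCommGroup M'] [Module R M'] [AddCommGroup T'] [Module R T']
  [AddCommGroup M''] [Module R M''] [AddCommGroup T''] [Module R T'']

/-- The same matrix, transposed: `M` is a transpose of `T`. -/
def symm (p : TransposePresentation R M T) : TransposePresentation R T M where
  m := p.n
  n := p.m
  A := p.A.transpose
  π := p.τ
  τ := p.π
  surjective_π := p.surjective_τ
  surjective_τ := p.surjective_π
  exact_π := p.exact_τ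
  exact_τ := by rw [Matrix.transpose_transpose]; exact p.exact_π

/-- `M × R^k` has the same transposes as `M`: adjoin `k` zero rows to the matrix. -/
def prodFree (p : TransposePresentation R M T) (k : Type) [Fintype k] :
    TransposePresentation R (M × (k → R)) T where
  m := p.m
  n := p.n ⊕ k
  A := Matrix.fromRows p.A 0
  π := (p.π.prodMap LinearMap.id) ∘ₗ
    (LinearEquiv.sumArrowLequivProdArrow p.n k R R).toLinearMap
  τ := p.τ
  surjective_π := (p.surjective_π.prodMap Function.surjective_id).comp
    (LinearEquiv.sumArrowLequivProdArrow p.n k R R).surjective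
  surjective_τ := p.surjective_τ
  exact_π := by
    intro v
    obtain ⟨⟨x, y⟩, rfl⟩ := (LinearEquiv.sumArrowLequivProdArrow p.n k R R).symm.surjective v
    simp only [LinearMap.comp_apply, LinearEquiv.coe_coe, LinearEquiv.apply_symm_apply,
      LinearMap.prodMap_apply, Prod.mk_eq_zero, LinearMap.id_apply, p.exact_π x, Set.mem_range]
    constructor
    · rintro ⟨⟨w, rfl⟩, rfl⟩
      refine ⟨w, ?_⟩
      ext (i | i) <;> simp
    · rintro ⟨w, hw⟩
      refine ⟨⟨w, ?_⟩, ?_⟩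
      · ext i; simpa using congrFun hw (Sum.inl i)
      · ext i; simpa using (congrFun hw (Sum.inr i)).symm
  exact_τ := by
    intro v
    rw [p.exact_τ v]
    simp only [Matrix.transpose_fromRows, Set.mem_range, Matrix.mulVecLin_apply]
    constructor
    · rintro ⟨w, rfl⟩
      exact ⟨Sum.elim w 0, by simp⟩
    · rintro ⟨w, rfl⟩
      exact ⟨w ∘ Sum.inl, by simp [Matrix.fromCols_mulVec]⟩

/-- `φ : M → M'` and `ψ : T' → T` are transposes of each other: `φ` lifts to a morphism `(U, V)`
of presentations, and `ψ` is induced by the transposed matrices. -/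
def AreTransposed (p : TransposePresentation R M T) (q : TransposePresentation R M' T')
    (φ : M →ₗ[R] M') (ψ : T' →ₗ[R] T) : Prop :=
  ∃ (U : Matrix q.n p.n R) (V : Matrix q.m p.m R), q.A * V = U * p.A ∧
    φ ∘ₗ p.π = q.π ∘ₗ U.mulVecLin ∧ ψ ∘ₗ q.τ = p.τ ∘ₗ V.transpose.mulVecLin

variable {p : TransposePresentation R M T} {q : TransposePresentation R M' T'}
  {r : TransposePresentation R M'' T''}

theorem AreTransposed.symm {φ : M →ₗ[R] M'} {ψ : T' →ₗ[R] T} (h : p.AreTransposed q φ ψ) :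
    q.symm.AreTransposed p.symm ψ φ := by
  obtain ⟨U, V, hUV, hφ, hψ⟩ := h
  refine ⟨V.transpose, U.transpose, ?_, hψ, hφ⟩
  have := congrArg Matrix.transpose hUV
  rw [Matrix.transpose_mul, Matrix.transpose_mul] at this
  exact this.symm

theorem AreTransposed.comp {φ : M →ₗ[R] M'} {ψ : T' →ₗ[R] T} {φ' : M' →ₗ[R] M''}
    {ψ' : T'' →ₗ[R] T'} (h : p.AreTransposed q φ ψ) (h' : q.AreTransposed r φ' ψ') :
    p.AreTransposed r (φ' ∘ₗ φ) (ψ ∘ₗ ψ') := by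
  obtain ⟨U, V, hUV, hφ, hψ⟩ := h
  obtain ⟨U', V', hUV', hφ', hψ'⟩ := h'
  refine ⟨U' * U, V' * V, ?_, ?_, ?_⟩
  · rw [← Matrix.mul_assoc, hUV', Matrix.mul_assoc, hUV, Matrix.mul_assoc]
  · rw [LinearMap.comp_assoc, hφ, ← LinearMap.comp_assoc, hφ', LinearMap.comp_assoc,
      Matrix.mulVecLin_mul]
  · rw [LinearMap.comp_assoc, hψ', ← LinearMap.comp_assoc, hψ, LinearMap.comp_assoc,
      Matrix.transpose_mul, Matrix.mulVecLin_mul]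

theorem AreTransposed.sub {φ φ' : M →ₗ[R] M'} {ψ ψ' : T' →ₗ[R] T} (h : p.AreTransposed q φ ψ)
    (h' : p.AreTransposed q φ' ψ') : p.AreTransposed q (φ - φ') (ψ - ψ') := by
  obtain ⟨U, V, hUV, hφ, hψ⟩ := h
  obtain ⟨U', V', hUV', hφ', hψ'⟩ := h'
  refine ⟨U - U', V - V', by rw [Matrix.mul_sub, Matrix.sub_mul, hUV, hUV'], ?_, ?_⟩
  · rw [LinearMap.sub_comp, hφ, hφ', mulVecLin_sub, LinearMap.comp_sub]
  · rw [LinearMap.sub_comp, hψ, hψ', Matrix.transpose_sub, mulVecLin_sub,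
      LinearMap.comp_sub]

variable (p q) in
theorem exists_areTransposed (φ : M →ₗ[R] M') : ∃ ψ : T' →ₗ[R] T, p.AreTransposed q φ ψ := by
  obtain ⟨U, hU⟩ := exists_matrix_comp_eq q.surjective_π (φ ∘ₗ p.π)
  obtain ⟨V, hV⟩ := exists_matrix_mul_eq q.exact_π (U * p.A) (by
    rw [Matrix.mulVecLin_mul, ← LinearMap.comp_assoc, hU, LinearMap.comp_assoc,
      p.exact_π.linearMap_comp_eq_zero, LinearMap.comp_zero])
  obtain ⟨ψ, hψ⟩ := exists_comp_eq_of_exact q.surjective_τ q.exact_τ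
    (p.τ ∘ₗ V.transpose.mulVecLin) (by
      rw [LinearMap.comp_assoc, ← Matrix.mulVecLin_mul, ← Matrix.transpose_mul, hV,
        Matrix.transpose_mul, Matrix.mulVecLin_mul, ← LinearMap.comp_assoc,
        p.exact_τ.linearMap_comp_eq_zero, LinearMap.zero_comp])
  exact ⟨ψ, U, V, hV, hU.symm, hψ⟩

variable (p q) in
theorem exists_areTransposed' (ψ : T' →ₗ[R] T) : ∃ φ : M →ₗ[R] M', p.AreTransposed q φ ψ := by
  obtain ⟨φ, h⟩ := exists_areTransposed q.symm p.symm ψ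
  exact ⟨φ, h.symm⟩

/-- The transpose of a map is unique up to maps that factor through the free module `R^m`. -/
theorem AreTransposed.exists_factor_of_zero {ψ : T' →ₗ[R] T} (h : p.AreTransposed q 0 ψ) :
    ∃ χ : T' →ₗ[R] (p.m → R), p.τ ∘ₗ χ = ψ := by
  obtain ⟨U, V, hUV, hφ, hψ⟩ := h
  -- `(U, V)` lifts the zero map, hence is homotopic to zero in degree `0`: `U = q.A * S`.
  obtain ⟨S, hS⟩ := exists_matrix_mul_eq q.exact_π U (by rw [← hφ, LinearMap.zero_comp])
  have hV : q.A * (V - S * p.A) = 0 := by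
    rw [Matrix.mul_sub, ← Matrix.mul_assoc, hS, hUV, sub_self]
  obtain ⟨χ, hχ⟩ := exists_comp_eq_of_exact q.surjective_τ q.exact_τ
    (V - S * p.A).transpose.mulVecLin (by
      rw [← Matrix.mulVecLin_mul, ← Matrix.transpose_mul, hV, Matrix.transpose_zero,
        Matrix.mulVecLin_zero])
  refine ⟨χ, ?_⟩
  rw [← LinearMap.cancel_right q.surjective_τ, LinearMap.comp_assoc, hχ, hψ,
    Matrix.transpose_sub, mulVecLin_sub, LinearMap.comp_sub, Matrix.transpose_mul,
    Matrix.mulVecLin_mul, ← LinearMap.comp_assoc (f := S.transpose.mulVecLin),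
    p.exact_τ.linearMap_comp_eq_zero, LinearMap.zero_comp, sub_zero]

end Maps

/-! ### G-projective modules and their transposes -/

section GProjective

variable {R : Type u} [CommRing R] {X Y : Type u} [AddCommGroup X] [Module R X]
  [AddCommGroup Y] [Module R Y]

theorem dotProduct_transpose_mulVec {m n : Type*} [Fintype m] [Fintype n] (A : Matrix n m R)
    (w : m → R) (y : n → R) : w ⬝ᵥ A.transpose.mulVec y = A.mulVec w ⬝ᵥ y := by
  rw [Matrix.dotProduct_mulVec, Matrix.vecMul_transpose]

/-- The embedding of `X^*` into `(R^n)^*`, identified with `R^n`, that is dual to `R^n → X`. -/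
noncomputable def dualEmbedding (p : TransposePresentation R X Y) :
    Module.Dual R X →ₗ[R] (p.n → R) :=
  open Classical in (dotProductEquiv R p.n).symm.toLinearMap ∘ₗ p.π.dualMap

theorem dotProduct_dualEmbedding (p : TransposePresentation R X Y) (v : p.n → R)
    (ξ : Module.Dual R X) :
    v ⬝ᵥ p.dualEmbedding ξ = ξ (p.π v) := by
  classical
  have := LinearMap.congr_fun ((dotProductEquiv R p.n).apply_symm_apply (p.π.dualMap ξ)) v
  rw [dotProduct_comm]
  exact this

theorem injective_dualEmbedding (p : TransposePresentation R X Y) :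
    Function.Injective p.dualEmbedding :=
  open Classical in
  (dotProductEquiv R p.n).symm.injective.comp
    (LinearMap.dualMap_injective_of_surjective p.surjective_π)

/-- Exactness of `X^* → R^n → R^m` at `R^n`, with `R^m` replaced by the image of `Aᵀ`. -/
theorem exact_dualEmbedding (p : TransposePresentation R X Y) :
    Function.Exact p.dualEmbedding p.A.transpose.mulVecLin.rangeRestrict := by
  intro y
  rw [← LinearMap.mem_ker, LinearMap.ker_rangeRestrict, LinearMap.mem_ker,
    Matrix.mulVecLin_apply]
  classical
  constructor
  · intro hy
    obtain ⟨ξ, hξ⟩ := exists_comp_eq_of_exact p.surjective_π p.exact_π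
      (dotProductEquiv R p.n y) (by
        refine LinearMap.ext fun w => ?_
        rw [LinearMap.comp_apply, dotProductEquiv_apply_apply, Matrix.mulVecLin_apply,
          dotProduct_comm, ← dotProduct_transpose_mulVec, hy, dotProduct_zero,
          LinearMap.zero_apply])
    refine ⟨ξ, ?_⟩
    rw [dualEmbedding, LinearMap.comp_apply, LinearEquiv.coe_coe, LinearEquiv.symm_apply_eq]
    exact hξ
  · rintro ⟨ξ, rfl⟩
    refine dotProduct_eq _ _ fun w => ?_
    rw [dotProduct_comm, dotProduct_transpose_mulVec, dotProduct_dualEmbedding]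
    have : p.π (p.A.mulVec w) = 0 := p.exact_π.apply_apply_eq_zero w
    simp [this]

theorem exact_subtype_range (p : TransposePresentation R X Y) :
    Function.Exact (LinearMap.range p.A.transpose.mulVecLin).subtype p.τ := by
  intro y
  rw [p.exact_τ y]
  simp

/-- The kernel of `X → X^{**}` vanishes if and only if `Ext^1(Tr X, R)` does. -/
theorem injective_eval_iff (p : TransposePresentation R X Y) :
    Function.Injective (Module.Dual.eval R X) ↔
    Subsingleton (Abelian.Ext (ModuleCat.of R Y) (ModuleCat.of R R) 1) := by
  classical
  rw [subsingleton_ext_one_iff (Submodule.subtype_injective _) p.surjective_τ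
    p.exact_subtype_range, injective_iff_map_eq_zero]
  constructor
  · intro h a
    obtain ⟨v, hv⟩ := (dotProductEquiv R p.n).surjective
      (a ∘ₗ p.A.transpose.mulVecLin.rangeRestrict)
    -- the form `a` gives an element `π v` of `X` on which all of `X^*` vanishes
    have h0 : p.π v = 0 := by
      refine h _ ?_
      ext ξ
      have := LinearMap.congr_fun hv (p.dualEmbedding ξ)
      rw [dotProductEquiv_apply_apply, dotProduct_dualEmbedding] at this
      simp [this, p.exact_dualEmbedding.apply_apply_eq_zero ξ]
    obtain ⟨w, rfl⟩ := (p.exact_π v).mp h0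
    refine ⟨dotProductEquiv R p.m w, ?_⟩
    ext ⟨_, y, rfl⟩
    have := LinearMap.congr_fun hv y
    rw [dotProductEquiv_apply_apply] at this
    exact (dotProduct_transpose_mulVec p.A w y).trans this
  · intro h x hx
    obtain ⟨v, rfl⟩ := p.surjective_π x
    -- pairing with `v` is zero on `X^*`, so it descends to a form on the image of `Aᵀ`
    obtain ⟨a, ha⟩ := exists_comp_eq_of_exact (LinearMap.surjective_rangeRestrict _)
      p.exact_dualEmbedding (dotProductEquiv R p.n v) (by
        ext ξ
        simpa [dotProduct_dualEmbedding] using LinearMap.congr_fun hx ξ)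
    obtain ⟨b, hb⟩ := h a
    obtain ⟨w, rfl⟩ := (dotProductEquiv R p.m).surjective b
    refine (p.exact_π v).mpr ⟨w, dotProduct_eq _ _ fun y => ?_⟩
    rw [← dotProductEquiv_apply_apply R p.n v, ← ha, ← hb]
    exact (dotProduct_transpose_mulVec p.A w y).symm

/-- The cokernel of `X → X^{**}` vanishes if and only if `Ext^2(Tr X, R)` does. -/
theorem surjective_eval_iff (p : TransposePresentation R X Y) :
    Function.Surjective (Module.Dual.eval R X) ↔
    Subsingleton (Abelian.Ext (ModuleCat.of R Y) (ModuleCat.of R R) 2) := by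
  classical
  rw [subsingleton_ext_add_two_iff (Submodule.subtype_injective _) p.surjective_τ
    p.exact_subtype_range _ 0, subsingleton_ext_one_iff p.injective_dualEmbedding
    (LinearMap.surjective_rangeRestrict _) p.exact_dualEmbedding]
  refine forall_congr' fun a => ?_
  rw [p.surjective_π.exists, (dotProductEquiv R p.n).surjective.exists]
  refine exists_congr fun v => ?_
  rw [LinearMap.ext_iff, LinearMap.ext_iff]
  simp [dotProduct_dualEmbedding]

/-- `X^*` is a second syzygy of `Tr X`, so dimension shifting applies twice. -/
theorem subsingleton_ext_dual_iff (p : TransposePresentation R X Y) (i : ℕ) :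
    Subsingleton (Abelian.Ext (ModuleCat.of R (Module.Dual R X)) (ModuleCat.of R R) (i + 1)) ↔
    Subsingleton (Abelian.Ext (ModuleCat.of R Y) (ModuleCat.of R R) (i + 3)) := by
  rw [subsingleton_ext_add_two_iff (Submodule.subtype_injective _) p.surjective_τ
    p.exact_subtype_range _ (i + 1), subsingleton_ext_add_two_iff p.injective_dualEmbedding
    (LinearMap.surjective_rangeRestrict _) p.exact_dualEmbedding]

/-- A description of G-projectivity that is symmetric in the module and its transpose. -/
theorem isGProjective_iff (p : TransposePresentation R X Y) : IsGProjective R X ↔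
    (∀ i, Subsingleton (Abelian.Ext (ModuleCat.of R X) (ModuleCat.of R R) (i + 1))) ∧
    (∀ i, Subsingleton (Abelian.Ext (ModuleCat.of R Y) (ModuleCat.of R R) (i + 1))) := by
  constructor
  · intro h
    refine ⟨fun i => h.ext_eq_zero _ i.succ_pos, ?_⟩
    rintro (_ | _ | i)
    · exact p.injective_eval_iff.mp h.reflexive.1
    · exact p.surjective_eval_iff.mp h.reflexive.2
    · exact (p.subsingleton_ext_dual_iff i).mp (h.ext_dual_eq_zero _ i.succ_pos)
  · rintro ⟨hX, hY⟩
    refine ⟨⟨p.injective_eval_iff.mpr (hY 0), p.surjective_eval_iff.mpr (hY 1)⟩, ?_, ?_⟩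
    · rintro (_ | i) hi
      · exact absurd hi (lt_irrefl 0)
      · exact hX i
    · rintro (_ | i) hi
      · exact absurd hi (lt_irrefl 0)
      · exact (p.subsingleton_ext_dual_iff i).mpr (hY (i + 2))

theorem isGProjective_comm (p : TransposePresentation R X Y) :
    IsGProjective R X ↔ IsGProjective R Y := by
  rw [p.isGProjective_iff, p.symm.isGProjective_iff, and_comm]

/-- `X × R^k` has the same transpose as `X`, so its G-projectivity needs no separate computation of
`Ext`. -/
theorem isGProjective_prodFree (p : TransposePresentation R X Y)
    (hX : IsGProjective R X) (k : Type) [Fintype k] :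
    IsGProjective R (X × (k → R)) :=
  (p.prodFree k).isGProjective_comm.mpr (p.isGProjective_comm.mp hX)

end GProjective

section Existence

variable {R : Type u} [CommRing R]

theorem exists_fg_transpose [IsNoetherianRing R] (X : FGModuleCat.{u} R) :
    ∃ Y : FGModuleCat.{u} R, Nonempty (TransposePresentation R X Y) := by
  obtain ⟨n, π, hπ⟩ := Module.Finite.exists_fin' R X
  obtain ⟨m, ρ, hρ⟩ := Module.Finite.exists_fin' R (LinearMap.ker π)
  let d := (LinearMap.ker π).subtype ∘ₗ ρ
  have hd : LinearMap.range d = LinearMap.ker π := by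
    simp [d, LinearMap.range_comp, LinearMap.range_eq_top.mpr hρ]
  have hA : (LinearMap.toMatrix' d).mulVecLin = d := by
    rw [← Matrix.toLin'_apply', Matrix.toLin'_toMatrix']
  let B := (LinearMap.toMatrix' d).transpose.mulVecLin
  refine ⟨FGModuleCat.of R ((Fin m → R) ⧸ LinearMap.range B), ⟨{
    m := Fin m
    n := Fin n
    A := LinearMap.toMatrix' d
    π := π
    τ := (LinearMap.range B).mkQ
    surjective_π := hπ
    surjective_τ := Submodule.mkQ_surjective _
    exact_π := by rw [hA]; exact LinearMap.exact_iff.mpr hd.symm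
    exact_τ := LinearMap.exact_iff.mpr (Submodule.ker_mkQ _) }⟩⟩

/-- Over a local ring, transposes in the sense of `IsTranspose` come from a matrix. -/
theorem nonempty_of_isTranspose [IsLocalRing R] {M T : FGModuleCat.{u} R}
    (h : IsTranspose M T) : Nonempty (TransposePresentation R M T) := by
  obtain ⟨F₁, F₀, δ, π, h, ⟨e⟩⟩ := h
  have := h.free₁
  have := h.free₀
  let b₁ := Module.finBasis R F₁
  let b₀ := Module.finBasis R F₀
  let A := LinearMap.toMatrix b₁ b₀ δ
  have hA : ∀ v, A.mulVec v = b₀.equivFun (δ (b₁.equivFun.symm v)) := fun v => by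
    have := LinearMap.toMatrix_mulVec_repr b₁ b₀ δ (b₁.equivFun.symm v)
    rwa [← b₁.equivFun_apply, LinearEquiv.apply_symm_apply] at this
  have hAt : ∀ v, A.transpose.mulVec v =
      b₁.dualBasis.equivFun (δ.dualMap (b₀.dualBasis.equivFun.symm v)) := fun v => by
    have := LinearMap.toMatrix_mulVec_repr b₀.dualBasis b₁.dualBasis δ.dualMap
      (b₀.dualBasis.equivFun.symm v)
    have hδ : LinearMap.toMatrix b₀.dualBasis b₁.dualBasis δ.dualMap = A.transpose :=
      LinearMap.toMatrix_transpose δ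
    rwa [← b₀.dualBasis.equivFun_apply, LinearEquiv.apply_symm_apply, hδ] at this
  refine ⟨{
    m := Fin _
    n := Fin _
    A := A
    π := π ∘ₗ b₀.equivFun.symm.toLinearMap
    τ := e.symm.toLinearMap ∘ₗ (LinearMap.range δ.dualMap).mkQ ∘ₗ
      b₁.dualBasis.equivFun.symm.toLinearMap
    surjective_π := h.surjective.comp b₀.equivFun.symm.surjective
    surjective_τ := e.symm.surjective.comp
      ((Submodule.mkQ_surjective _).comp b₁.dualBasis.equivFun.symm.surjective)
    exact_π := fun v => ?_
    exact_τ := fun v => ?_ }⟩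
  · refine (h.exact _).trans ?_
    simp only [Set.mem_range, Matrix.mulVecLin_apply, hA, b₁.equivFun.symm.surjective.exists,
      LinearEquiv.coe_coe, ← LinearEquiv.eq_symm_apply]
  · simp only [LinearMap.comp_apply, LinearEquiv.coe_coe, EmbeddingLike.map_eq_zero_iff,
      Submodule.mkQ_apply, Submodule.Quotient.mk_eq_zero, LinearMap.mem_range,
      Set.mem_range, Matrix.mulVecLin_apply, hAt, b₀.dualBasis.equivFun.symm.surjective.exists,
      ← LinearEquiv.eq_symm_apply]

end Existence

/-! ### Approximations and transposes -/

section Approximations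

variable {R : Type u} [CommRing R]

/-- Every finitely generated module over a Noetherian ring has a left approximation by finite
free modules: evaluation at generators of the dual. -/
theorem exists_left_free_approx [IsNoetherianRing R] (T : Type u) [AddCommGroup T] [Module R T]
    [Module.Finite R T] : ∃ (k : ℕ) (ε : T →ₗ[R] (Fin k → R)),
      ∀ {m : Type} (χ : T →ₗ[R] (m → R)),
        ∃ χ' : (Fin k → R) →ₗ[R] (m → R), χ' ∘ₗ ε = χ := by
  obtain ⟨k, g, hg⟩ := Module.Finite.exists_fin' R (Module.Dual R T)
  refine ⟨k, LinearMap.pi fun j => g (Pi.single j 1), fun χ => ?_⟩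
  choose c hc using fun i => hg (LinearMap.proj i ∘ₗ χ)
  refine ⟨(Matrix.of c).mulVecLin, ?_⟩
  ext t i
  have := LinearMap.congr_fun (hc i) t
  rw [pi_eq_sum_univ' (c i), map_sum] at this
  simpa [Matrix.mulVec, dotProduct] using this

/-- The left approximation of `T` is `(ψ, ε) : T → Y × R^k`, where `ψ` is a transpose of the given
right approximation of `M` and `ε` is a left approximation by free modules. -/
theorem lap_of_rap [IsNoetherianRing R] {M T : FGModuleCat.{u} R}
    (p : TransposePresentation R M T) (h : rap (gProjective R) M) : lap (gProjective R) T := by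
  obtain ⟨X, φ, hX, hφ⟩ := h
  obtain ⟨Y, ⟨q⟩⟩ := exists_fg_transpose X
  obtain ⟨ψ, hψ⟩ := exists_areTransposed q p φ
  obtain ⟨k, ε, hε⟩ := exists_left_free_approx (R := R) T
  refine ⟨FGModuleCat.of R (Y × (Fin k → R)), ψ.prod ε,
    q.symm.isGProjective_prodFree (q.isGProjective_comm.mp hX) (Fin k), fun Z hZ f => ?_⟩
  obtain ⟨Z', ⟨r⟩⟩ := exists_fg_transpose Z
  obtain ⟨f', hf'⟩ := exists_areTransposed' r.symm p f
  obtain ⟨g, hg⟩ := hφ Z' (r.isGProjective_comm.mp hZ) f'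
  obtain ⟨g', hg'⟩ := exists_areTransposed r.symm q g
  -- `f` and `g' ∘ ψ` are both transposes of `f' = φ ∘ g`
  have h0 := hf'.sub (hg'.comp hψ)
  rw [← hg, sub_self] at h0
  obtain ⟨χ, hχ⟩ := h0.exists_factor_of_zero
  obtain ⟨χ', hχ'⟩ := hε χ
  refine ⟨g'.coprod (r.symm.τ ∘ₗ χ'), ?_⟩
  rw [LinearMap.coprod_comp_prod, LinearMap.comp_assoc, hχ', hχ, add_sub_cancel]

/-- The right approximation of `T` is `Y × R^m → T`, given by a transpose of the left approximation
of `M` and by the projection `τ : R^m → T`. -/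
theorem rap_of_lap [IsNoetherianRing R] {M T : FGModuleCat.{u} R}
    (p : TransposePresentation R M T) (h : lap (gProjective R) M) : rap (gProjective R) T := by
  obtain ⟨X, φ, hX, hφ⟩ := h
  obtain ⟨Y, ⟨q⟩⟩ := exists_fg_transpose X
  obtain ⟨ψ, hψ⟩ := exists_areTransposed p q φ
  refine ⟨FGModuleCat.of R (Y × (p.m → R)), ψ.coprod p.τ,
    q.symm.isGProjective_prodFree (q.isGProjective_comm.mp hX) p.m, fun Z hZ f => ?_⟩
  obtain ⟨Z', ⟨r⟩⟩ := exists_fg_transpose Z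
  obtain ⟨f', hf'⟩ := exists_areTransposed' p r.symm f
  obtain ⟨g, hg⟩ := hφ Z' (r.isGProjective_comm.mp hZ) f'
  obtain ⟨g', hg'⟩ := exists_areTransposed q r.symm g
  -- `f` and `ψ ∘ g'` are both transposes of `f' = g ∘ φ`
  have h0 := hf'.sub (hψ.comp hg')
  rw [← hg, sub_self] at h0
  obtain ⟨χ, hχ⟩ := h0.exists_factor_of_zero
  refine ⟨g'.prod χ, ?_⟩
  rw [LinearMap.coprod_comp_prod, hχ, add_sub_cancel]

theorem rap_iff_lap [IsNoetherianRing R] {M T : FGModuleCat.{u} R}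
    (p : TransposePresentation R M T) : rap (gProjective R) M ↔ lap (gProjective R) T :=
  ⟨p.lap_of_rap, p.symm.rap_of_lap⟩

end Approximations
end TransposePresentation
end GProj

theorem mainTheorem7 (R : Type u) [CommRing R] [IsNoetherianRing R] [HenselianLocalRing R] :
    (∀ M T : FGModuleCat.{u} R, GProj.IsTranspose M T →
      (GProj.rap (GProj.gProjective R) M ↔ GProj.lap (GProj.gProjective R) T) ∧
      (GProj.lap (GProj.gProjective R) M ↔ GProj.rap (GProj.gProjective R) T)) ∧
    (GProj.ClosedUnderTranspose (GProj.rap (GProj.gProjective R)) ↔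
      GProj.lap (GProj.gProjective R) ≤ GProj.rap (GProj.gProjective R)) := by
  have key : ∀ M T : FGModuleCat.{u} R, GProj.IsTranspose M T →
      (GProj.rap (GProj.gProjective R) M ↔ GProj.lap (GProj.gProjective R) T) ∧
      (GProj.lap (GProj.gProjective R) M ↔ GProj.rap (GProj.gProjective R) T) := by
    intro M T h
    obtain ⟨p⟩ := GProj.TransposePresentation.nonempty_of_isTranspose h
    exact ⟨p.rap_iff_lap, p.symm.rap_iff_lap.symm⟩
  refine ⟨key, fun h L hL => ?_, fun h M T hMT hM => h T ((key M T hMT).1.mp hM)⟩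
  -- `Tr L` and `Tr (Tr L)` lie in `rap`, so `Tr L` also lies in `lap`, and `L` in `rap`.
  obtain ⟨T, hT⟩ := GProj.exists_isTranspose L
  obtain ⟨T', hT'⟩ := GProj.exists_isTranspose T
  have hTrap := (key L T hT).2.mp hL
  exact (key L T hT).1.mpr ((key T T' hT').2.mpr (h T T' hT' hTrap))
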